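/- Let $(\mathscr K,\otimes,\mathbf 1,\alpha,\lambda,\rho)$ be an $\mathbf{Ab}$-enriched monoidal category: a monoidal category whose hom-sets are abelian groups such that composition and the tensor product of morphisms are biadditive. Let $(M,\mu,\eta)$ be a monoid object in $\mathscr K$ and let $(X,\nu,\omega)$ be an $M$-bimodule object, with left action $\nu:M\otimes X\to X$ and right action $\omega:X\otimes M\to X$. Put $M^{\otimes 0}=\mathbf 1$, $M^{\otimes 1}=M$, and $M^{\otimes (k+1)}=M^{\otimes k}\otimes M$ for $k\ge 1$ (left-bracketed tensor powers), and let $A^k=\operatorname{Hom}_{\mathscr K}(M^{\otimes k},X)$ for $k\ge 0$. For $g:M^{\otimes p}\to M^{\otimes q}$ with $p,q\ge 1$ and $r\ge 0$ write $g\otimes 1^{r}:M^{\otimes(p+r)}\to M^{\otimes (q+r)}$ for $(\cdots((g\otimes 1_M)\otimes 1_M)\cdots)\otimes 1_M$ with $r$ factors $1_M$. For $k\ge 1$ let $\alpha^1_{M^{\otimes (k+1)}}:M^{\otimes(k+1)}\to M\otimes M^{\otimes k}$ be the composite of associators given by $\alpha^1_{M^{\otimes 2}}=1$ and $\alpha^1_{M^{\otimes(k+2)}}=\alpha_{M,M^{\otimes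 k},M}\circ(\alpha^1_{M^{\otimes(k+1)}}\otimes 1_M)$. Coface maps $\delta^i:A^k\to A^{k+1}$, $0\le i\le k+1$: * for $k=0$: $\delta^0(f)=\nu\circ(1_M\otimes f)\circ\rho_M^{-1}$ and $\delta^1(f)=\omega\circ(f\otimes 1_M)\circ\lambda_M^{-1}$; * for $k\ge 1$: $\delta^0(f)=\nu\circ(1_M\otimes f)\circ\alpha^1_{M^{\otimes(k+1)}}$, $\ \delta^{k+1}(f)=\omega\circ(f\otimes 1_M)$, and for $1\le i\le k$, $\ \delta^i(f)=f\circ(m_i\otimes 1^{k-i})$, where $m_1=\mu:M^{\otimes 2}\to M$ and $m_i=(1_{M^{\otimes(i-1)}}\otimes\mu)\circ\alpha_{M^{\otimes(i-1)},M,M}:M^{\otimes(i+1)}\to M^{\otimes i}$ for $i\ge 2$ (so that $\delta^i$ multiplies the $i$-th and $(i+1)$-st factors). Codegeneracy maps $\sigma^i:A^{k+1}\to A^k$, $0\le i\le k$ (inserting $\eta$ after the first $i$ factors): * for $k=0$: $\sigma^0(f)=f\circ\eta$; * for $k\ge 1$ and $i=0$: $\sigma^0(f)=f\circ\big(((\eta\otimes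 1_M)\circ\lambda_M^{-1})\otimes 1^{k-1}\big)$; * for $0<i<k$: $\sigma^i(f)=f\circ(u_i\otimes 1^{k-i-1})$ with $u_i=\alpha^{-1}_{M^{\otimes i},M,M}\circ(1_{M^{\otimes i}}\otimes(\eta\otimes 1_M))\circ(1_{M^{\otimes i}}\otimes\lambda_M^{-1}):M^{\otimes(i+1)}\to M^{\otimes(i+2)}$; * for $i=k=1$: $\sigma^1(f)=f\circ(1_M\otimes\eta)\circ\rho_M^{-1}$; * for $i=k\ge 2$: $\sigma^k(f)=f\circ\alpha^{-1}_{M^{\otimes(k-1)},M,M}\circ(1_{M^{\otimes(k-1)}}\otimes(1_M\otimes\eta))\circ(1_{M^{\otimes(k-1)}}\otimes\rho_M^{-1})$. **Theorem.** The maps $\delta^i$ and $\sigma^i$ are group homomorphisms and satisfy all cosimplicial identities: $$\delta^j\delta^i=\delta^i\delta^{j-1}\ (i<j),\qquad \sigma^j\sigma^i=\sigma^i\sigma^{j+1}\ (i\le j),$$ $$\sigma^j\delta^i=\begin{cases}\delta^i\sigma^{j-1}& i<j,\\ 1& i=j\text{ or }i=j+1,\\ \delta^{i-1}\sigma^{j}&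 i>j+1.\end{cases}$$ Hence they form a cosimplicial abelian group: there is a functor $A:\mathbf\Delta\to\mathbf{Ab}$ with $A([k])=A^k$ that sends the coface and codegeneracy generators of $\mathbf\Delta$ to the maps $\delta^i$ and $\sigma^i$. -/

import Mathlib

open CategoryTheory MonoidalCategory

universe v u

noncomputable section

namespace Hochschild

variable {C : Type u} [Category.{v} C] [MonoidalCategory C]

/-- The left-bracketed tensor powers of an object: `M^{⊗0} = 𝟙_ C`, `M^{⊗1} = M` and
`M^{⊗(k+1)} = M^{⊗k} ⊗ M` for `k ≥ 1`. -/
def tpow (M : C) : ℕ → C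
  | 0 => 𝟙_ C
  | 1 => M
  | k + 2 => tpow M (k + 1) ⊗ M

/-- The composite of (whiskered) associators `M^{⊗(k+2)} ⟶ M ⊗ M^{⊗(k+1)}` which isolates the
first tensor factor:
`α_{M, M^{⊗k}, M} ∘ ⋯ ∘ ((α_{M, M^{⊗2}, M} ⊗ 1) ⋯ ⊗ 1) ∘ ((α_{M, M, M} ⊗ 1) ⋯ ⊗ 1)`. -/
def isolateFirst (M : C) : (k : ℕ) → (tpow M (k + 2) ⟶ M ⊗ tpow M (k + 1))
  | 0 => 𝟙 (M ⊗ M)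
  | k + 1 => isolateFirst M k ▷ M ≫ (α_ M (tpow M (k + 1)) M).hom

/-- The map `M^{⊗(k+2)} ⟶ M^{⊗(k+1)}` which multiplies the adjacent factors number `i + 1` and
`i + 2` (counted from `1`), for `0 ≤ i ≤ k`. If these are the last two factors, it is `μ` when
`k = 0` and `(1 ⊗ μ) ∘ α_{M^{⊗k}, M, M}` when `k ≥ 1`; otherwise it is the corresponding map on
the first `k + 1` factors, tensored with `1_M` on the right. -/
def mulAt (M : Mon C) : (k : ℕ) → Fin (k + 1) → (tpow M.X (k + 2) ⟶ tpow M.X (k + 1))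
  | 0, _ => M.mon.mul
  | k + 1, i =>
      Fin.lastCases (motive := fun _ => tpow M.X (k + 3) ⟶ tpow M.X (k + 2))
        ((α_ (tpow M.X (k + 1)) M.X M.X).hom ≫ tpow M.X (k + 1) ◁ M.mon.mul)
        (fun j => mulAt M k j ▷ M.X) i

/-- The map `M^{⊗k} ⟶ M^{⊗(k+1)}` which inserts the unit after the first `i` factors, for
`0 ≤ i ≤ k`.
* For `k = 0` it is `η`.
* For `k = 1` it is `(η ⊗ 1) ∘ λ⁻¹` if `i = 0` and `(1 ⊗ η) ∘ ρ⁻¹` if `i = 1`.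
* For `k ≥ 2` it is `α⁻¹ ∘ (1 ⊗ (1 ⊗ η)) ∘ (1 ⊗ ρ⁻¹)` if `i = k`,
  `α⁻¹ ∘ (1 ⊗ (η ⊗ 1)) ∘ (1 ⊗ λ⁻¹)` if `i = k - 1`, and otherwise the corresponding map on the
  first `k - 1` factors, tensored with `1_M` on the right. -/
def unitAt (M : Mon C) : (k : ℕ) → Fin (k + 1) → (tpow M.X k ⟶ tpow M.X (k + 1))
  | 0, _ => M.mon.one
  | 1, i =>
      Fin.lastCases (motive := fun _ => tpow M.X 1 ⟶ tpow M.X 2)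
        ((ρ_ M.X).inv ≫ M.X ◁ M.mon.one)
        (fun _ => (λ_ M.X).inv ≫ M.mon.one ▷ M.X) i
  | k + 2, i =>
      Fin.lastCases (motive := fun _ => tpow M.X (k + 2) ⟶ tpow M.X (k + 3))
        (tpow M.X (k + 1) ◁ (ρ_ M.X).inv ≫ tpow M.X (k + 1) ◁ (M.X ◁ M.mon.one) ≫
          (α_ (tpow M.X (k + 1)) M.X M.X).inv)
        (fun j =>
          Fin.lastCases (motive := fun _ => tpow M.X (k + 2) ⟶ tpow M.X (k + 3))
            (tpow M.X (k + 1) ◁ (λ_ M.X).inv ≫ tpow M.X (k + 1) ◁ (M.mon.one ▷ M.X) ≫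
              (α_ (tpow M.X (k + 1)) M.X M.X).inv)
            (fun l => unitAt M (k + 1) l.castSucc ▷ M.X) j) i

/-- The `i`-th coface `A^k → A^{k+1}`, `0 ≤ i ≤ k + 1`, as a map of sets, where
`A^k = Hom(M^{⊗k}, X)`. -/
def cofaceFun {M : Mon C} (X : Bimod M M) :
    (k : ℕ) → Fin (k + 2) → (tpow M.X k ⟶ X.X) → (tpow M.X (k + 1) ⟶ X.X)
  | 0, i, f =>
      Fin.cases (motive := fun _ => tpow M.X 1 ⟶ X.X)
        ((ρ_ M.X).inv ≫ M.X ◁ f ≫ X.actLeft)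
        (fun _ => (λ_ M.X).inv ≫ f ▷ M.X ≫ X.actRight) i
  | k + 1, i, f =>
      Fin.cases (motive := fun _ => tpow M.X (k + 2) ⟶ X.X)
        (isolateFirst M.X k ≫ M.X ◁ f ≫ X.actLeft)
        (fun j =>
          Fin.lastCases (motive := fun _ => tpow M.X (k + 2) ⟶ X.X)
            (f ▷ M.X ≫ X.actRight)
            (fun l => mulAt M k l ≫ f) j) i

variable [Preadditive C]

theorem cofaceFun_add [MonoidalPreadditive C] {M : Mon C} (X : Bimod M M) (k : ℕ)
    (i : Fin (k + 2)) (f g : tpow M.X k ⟶ X.X) :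
    cofaceFun X k i (f + g) = cofaceFun X k i f + cofaceFun X k i g := by
  cases k with
  | zero =>
    -- the domain of `f` and `g` is the unit object by definition
    have hl (f g : 𝟙_ C ⟶ X.X) : (ρ_ M.X).inv ≫ M.X ◁ (f + g) ≫ X.actLeft =
        (ρ_ M.X).inv ≫ M.X ◁ f ≫ X.actLeft + (ρ_ M.X).inv ≫ M.X ◁ g ≫ X.actLeft := by simp
    have hr (f g : 𝟙_ C ⟶ X.X) : (λ_ M.X).inv ≫ (f + g) ▷ M.X ≫ X.actRight =
        (λ_ M.X).inv ≫ f ▷ M.X ≫ X.actRight + (λ_ M.X).inv ≫ g ▷ M.X ≫ X.actRight := by simp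
    induction i using Fin.cases with
    | zero => exact hl f g
    | succ j => exact hr f g
  | succ k =>
    induction i using Fin.cases with
    | zero => simp [cofaceFun]
    | succ j =>
      induction j using Fin.lastCases with
      | last =>
        simp only [cofaceFun, Fin.cases_succ, Fin.lastCases_last]
        exact (congrArg (· ≫ X.actRight) (MonoidalPreadditive.add_whiskerRight f g)).trans
          (Preadditive.add_comp _ _ _ _ _ _)
      | cast l =>
        simp only [cofaceFun, Fin.cases_succ, Fin.lastCases_castSucc, Preadditive.comp_add]

/-- The abelian group `A^k = Hom(M^{⊗k}, X)`; in particular `A^0 = Hom(𝟙_ C, X)`. -/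
abbrev cochain {M : Mon C} (X : Bimod M M) (k : ℕ) : AddCommGrpCat.{v} :=
  AddCommGrpCat.of (tpow M.X k ⟶ X.X)

/-- The coface homomorphism `δ^i : A^k → A^{k+1}`, `0 ≤ i ≤ k + 1`. -/
def coface [MonoidalPreadditive C] {M : Mon C} (X : Bimod M M) (k : ℕ) (i : Fin (k + 2)) :
    cochain X k ⟶ cochain X (k + 1) :=
  AddCommGrpCat.ofHom (AddMonoidHom.mk' (cofaceFun X k i) (cofaceFun_add X k i))

/-- The codegeneracy homomorphism `σ^i : A^{k+1} → A^k`, `0 ≤ i ≤ k`, which is precomposition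
with the insertion of the unit after the first `i` factors. -/
def codegeneracy {M : Mon C} (X : Bimod M M) (k : ℕ) (i : Fin (k + 1)) :
    cochain X (k + 1) ⟶ cochain X k :=
  AddCommGrpCat.ofHom (Preadditive.leftComp X.X (unitAt M k i))

end Hochschild

end

/-! ### Tensor powers: recursion on the last factor, uniform in the degree -/

namespace Hochschild

variable {C : Type u} [Category.{v} C] [MonoidalCategory C]

/-! The cosimplicial identities reduce to identities between three kinds of maps of tensor powers
(multiplying neighbours, inserting a unit, isolating the first factor) together with the bimodule
axioms. The monoid and bimodule laws are needed only where two operations meet; operations in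
disjoint places commute by interchange and coherence.

As the powers are bracketed to the left, the induction is on the last factor: an operation at the
right end has an explicit formula, any other is whiskered from one degree lower. Unitors inserted in
degree zero (`tpowSucc`, `splitFirst`) make these recursions uniform. The left action works at the
opposite end, so `splitFirst` needs its own compatibility lemmas.

For the functor, the category presented by faces, degeneracies and the cosimplicial relations is
compared with the simplex category. The canonical functor is full because faces and degeneracies
generate, and faithful because epi-mono factorizations are unique, while a word in faces alone, or
in degeneracies alone, is determined by its underlying map. Hence any data satisfying the identities
extend to a functor on the simplex category. -/

/-- The isomorphism `M^{⊗(k+1)} ≅ M^{⊗k} ⊗ M`, valid for all `k ≥ 0`. -/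
noncomputable def tpowSucc (M : C) : (k : ℕ) → (tpow M (k + 1) ≅ tpow M k ⊗ M)
  | 0 => (λ_ M).symm
  | _ + 1 => Iso.refl _

/-- The map `M^{⊗(k+1)} ⟶ M ⊗ M^{⊗k}` isolating the first factor, valid for all `k ≥ 0`. -/
noncomputable def splitFirst (M : C) : (k : ℕ) → (tpow M (k + 1) ⟶ M ⊗ tpow M k)
  | 0 => (ρ_ M).inv
  | k + 1 => isolateFirst M k

theorem splitFirst_succ (M : C) (k : ℕ) :
    splitFirst M (k + 1) = (tpowSucc M (k + 1)).hom ≫ splitFirst M k ▷ M ≫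
      (α_ M (tpow M k) M).hom ≫ M ◁ (tpowSucc M k).inv := by
  cases k with
  | zero =>
    have h : 𝟙 (M ⊗ M) = 𝟙 (M ⊗ M) ≫ (ρ_ M).inv ▷ M ≫ (α_ M (𝟙_ C) M).hom ≫
      M ◁ (λ_ M).hom := by simp
    exact h
  | succ k =>
    have h : isolateFirst M (k + 1) = 𝟙 (tpow M (k + 2) ⊗ M) ≫ isolateFirst M k ▷ M ≫
      (α_ M (tpow M (k + 1)) M).hom ≫ M ◁ (𝟙 (tpow M (k + 1) ⊗ M)) := by
      simp only [whiskerLeft_id, Category.id_comp]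
      exact ((isolateFirst M k ▷ M) ≫= (Category.comp_id _)).symm
    exact h

variable (M : Mon C)

/-- For `k = 0` the left factor is the unit object, and coherence of the left unitor removes it.
This, `mulAt_castSucc`, `unitAt_last` and `unitAt_castSucc` replace the case distinctions of the
definitions in all later inductions. -/
theorem mulAt_last (k : ℕ) :
    mulAt M k (Fin.last k) = (tpowSucc M.X (k + 1)).hom ≫ (tpowSucc M.X k).hom ▷ M.X ≫
      (α_ (tpow M.X k) M.X M.X).hom ≫ tpow M.X k ◁ M.mon.mul ≫ (tpowSucc M.X k).inv := by
  cases k with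
  | zero =>
    have h : M.mon.mul = 𝟙 (M.X ⊗ M.X) ≫ (λ_ M.X).inv ▷ M.X ≫
        (α_ (𝟙_ C) M.X M.X).hom ≫ 𝟙_ C ◁ M.mon.mul ≫ (λ_ M.X).hom := by simp
    exact h
  | succ k =>
    have h : (α_ (tpow M.X (k + 1)) M.X M.X).hom ≫ tpow M.X (k + 1) ◁ M.mon.mul =
        𝟙 ((tpow M.X (k + 1) ⊗ M.X) ⊗ M.X) ≫ (𝟙 (tpow M.X (k + 1) ⊗ M.X)) ▷ M.X ≫
          (α_ (tpow M.X (k + 1)) M.X M.X).hom ≫ tpow M.X (k + 1) ◁ M.mon.mul ≫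
          𝟙 (tpow M.X (k + 1) ⊗ M.X) := by simp
    exact (Fin.lastCases_last (motive := fun _ => tpow M.X (k + 3) ⟶ tpow M.X (k + 2))
      (cast := fun j => mulAt M k j ▷ M.X)).trans h

theorem mulAt_castSucc (k : ℕ) (i : Fin (k + 1)) :
    mulAt M (k + 1) i.castSucc = (tpowSucc M.X (k + 2)).hom ≫ mulAt M k i ▷ M.X ≫
      (tpowSucc M.X (k + 1)).inv := by
  have h : mulAt M k i ▷ M.X = 𝟙 (tpow M.X (k + 2) ⊗ M.X) ≫ mulAt M k i ▷ M.X ≫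
    𝟙 (tpow M.X (k + 1) ⊗ M.X) := by simp
  exact (Fin.lastCases_castSucc (motive := fun _ => tpow M.X (k + 3) ⟶ tpow M.X (k + 2))
    (cast := fun j => mulAt M k j ▷ M.X) i).trans h

theorem unitAt_last (k : ℕ) :
    unitAt M k (Fin.last k) = (ρ_ (tpow M.X k)).inv ≫ tpow M.X k ◁ M.mon.one ≫
      (tpowSucc M.X k).inv := by
  rcases k with _ | _ | k
  · have h : M.mon.one = (ρ_ (𝟙_ C)).inv ≫ 𝟙_ C ◁ M.mon.one ≫ (λ_ M.X).hom := by
      simp [unitors_equal]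
    exact h
  · have h : (ρ_ M.X).inv ≫ M.X ◁ M.mon.one =
      (ρ_ M.X).inv ≫ M.X ◁ M.mon.one ≫ 𝟙 (M.X ⊗ M.X) := by simp
    exact (Fin.lastCases_last (n := 1) (motive := fun _ => tpow M.X 1 ⟶ tpow M.X 2)
      (cast := fun _ => (λ_ M.X).inv ≫ M.mon.one ▷ M.X)).trans h
  · have h : tpow M.X (k + 1) ◁ (ρ_ M.X).inv ≫ tpow M.X (k + 1) ◁ (M.X ◁ M.mon.one) ≫
          (α_ (tpow M.X (k + 1)) M.X M.X).inv =
        (ρ_ (tpow M.X (k + 1) ⊗ M.X)).inv ≫ (tpow M.X (k + 1) ⊗ M.X) ◁ M.mon.one ≫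
        𝟙 ((tpow M.X (k + 1) ⊗ M.X) ⊗ M.X) := by simp
    exact (Fin.lastCases_last (motive := fun _ => tpow M.X (k + 2) ⟶ tpow M.X (k + 3))
      (cast := _)).trans h

/-- The separate clause for a unit inserted just before the last factor is no exception: by the
triangle identity it is the insertion at the end of the shorter power, whiskered by `M`. -/
theorem unitAt_add_two_castSucc (k : ℕ) (i : Fin (k + 2)) :
    unitAt M (k + 2) i.castSucc = unitAt M (k + 1) i ▷ M.X := by
  refine (Fin.lastCases_castSucc (motive := fun _ => tpow M.X (k + 2) ⟶ tpow M.X (k + 3))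
    (last := _) (cast := _) i).trans ?_
  induction i using Fin.lastCases with
  | cast i =>
    exact Fin.lastCases_castSucc (motive := fun _ => tpow M.X (k + 2) ⟶ tpow M.X (k + 3))
      (last := _) (cast := fun l => unitAt M (k + 1) l.castSucc ▷ M.X) i
  | last =>
    have h : tpow M.X (k + 1) ◁ (λ_ M.X).inv ≫ tpow M.X (k + 1) ◁ (M.mon.one ▷ M.X) ≫
      (α_ (tpow M.X (k + 1)) M.X M.X).inv = ((ρ_ (tpow M.X (k + 1))).inv ≫
        tpow M.X (k + 1) ◁ M.mon.one ≫ 𝟙 (tpow M.X (k + 1) ⊗ M.X)) ▷ M.X := by simp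
    exact (Fin.lastCases_last (motive := fun _ => tpow M.X (k + 2) ⟶ tpow M.X (k + 3))
      (cast := fun l => unitAt M (k + 1) l.castSucc ▷ M.X)).trans
      (h.trans (congrArg (· ▷ M.X) (unitAt_last M (k + 1))).symm)

theorem unitAt_castSucc (k : ℕ) (i : Fin (k + 1)) :
    unitAt M (k + 1) i.castSucc = (tpowSucc M.X k).hom ≫ unitAt M k i ▷ M.X ≫
      (tpowSucc M.X (k + 1)).inv := by
  rcases k with _ | k
  · obtain rfl := Fin.eq_zero i
    have h : (λ_ M.X).inv ≫ M.mon.one ▷ M.X =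
      (λ_ M.X).inv ≫ M.mon.one ▷ M.X ≫ 𝟙 (M.X ⊗ M.X) := by simp
    exact h
  · have h : unitAt M (k + 1) i ▷ M.X = 𝟙 (tpow M.X (k + 1) ⊗ M.X) ≫
      unitAt M (k + 1) i ▷ M.X ≫ 𝟙 (tpow M.X (k + 2) ⊗ M.X) := by simp
    exact (unitAt_add_two_castSucc M k i).trans h

/-! ### Relations between multiplications and unit insertions -/

/-- When `i = j` is the last position this is associativity of `μ`; when only `j` is last the two
operations are disjoint and interchange applies; otherwise both are whiskered from lower degree. The
lemmas below follow the same scheme. -/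
theorem mulAt_comp_mulAt (k : ℕ) (i j : Fin (k + 1)) (hij : i ≤ j) :
    mulAt M (k + 1) j.succ ≫ mulAt M k i = mulAt M (k + 1) i.castSucc ≫ mulAt M k j := by
  induction j using Fin.lastCases with
  | last =>
    rw [Fin.succ_last, mulAt_castSucc]
    induction i using Fin.lastCases with
    | last =>
      have h : (M.mon.mul ▷ M.X) ≫ M.mon.mul =
        (α_ M.X M.X M.X).hom ≫ M.X ◁ M.mon.mul ≫ M.mon.mul := MonObj.mul_assoc M.X
      rw [mulAt_last, mulAt_last]
      simp only [Category.assoc, Iso.inv_hom_id_assoc, comp_whiskerRight,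
        inv_hom_whiskerRight_assoc, whisker_exchange_assoc, whisker_assoc]
      rw [← whiskerLeft_comp_assoc (tpow M.X k) (M.mon.mul ▷ M.X), h]
      simp
    | cast i =>
      cases k with
      | zero => exact i.elim0
      | succ k =>
        rw [mulAt_last, mulAt_last, mulAt_castSucc]
        simp [whisker_exchange_assoc]
  | cast j =>
    induction i using Fin.lastCases with
    | last => exact absurd hij (by simp)
    | cast i =>
      cases k with
      | zero => exact i.elim0
      | succ k =>
        rw [Fin.succ_castSucc, mulAt_castSucc, mulAt_castSucc M (k + 1), mulAt_castSucc M k i,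
          mulAt_castSucc M k j]
        simp only [Category.assoc, Iso.inv_hom_id_assoc, ← comp_whiskerRight_assoc]
        rw [mulAt_comp_mulAt k i j hij, mulAt_castSucc]
        simp only [Category.assoc]

theorem unitAt_comp_unitAt (k : ℕ) (i j : Fin (k + 1)) (hij : i ≤ j) :
    unitAt M k j ≫ unitAt M (k + 1) i.castSucc = unitAt M k i ≫ unitAt M (k + 1) j.succ := by
  induction j using Fin.lastCases with
  | last =>
    rw [Fin.succ_last, unitAt_castSucc, unitAt_last, unitAt_last]
    simp [whisker_exchange_assoc]
  | cast j =>
    induction i using Fin.lastCases with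
    | last => exact absurd hij (by simp)
    | cast i =>
      cases k with
      | zero => exact i.elim0
      | succ k =>
        rw [Fin.succ_castSucc, unitAt_castSucc, unitAt_castSucc M (k + 1), unitAt_castSucc M k i,
          unitAt_castSucc M (k + 1)]
        simp only [Category.assoc, Iso.inv_hom_id_assoc, ← comp_whiskerRight_assoc]
        rw [← unitAt_comp_unitAt k i j hij, unitAt_castSucc]

theorem unitAt_castSucc_comp_mulAt (k : ℕ) (i : Fin (k + 1)) :
    unitAt M (k + 1) i.castSucc ≫ mulAt M k i = 𝟙 (tpow M.X (k + 1)) := by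
  induction i using Fin.lastCases with
  | last =>
    -- The new unit is the left one of the two factors being multiplied, so the left unit law is the
    -- relevant one.
    have h : (M.mon.one ▷ M.X) ≫ M.mon.mul = (λ_ M.X).hom := MonObj.one_mul M.X
    rw [unitAt_castSucc, mulAt_last, unitAt_last]
    simp only [Category.assoc, Iso.inv_hom_id_assoc, comp_whiskerRight,
      inv_hom_whiskerRight_assoc, associator_naturality_middle_assoc]
    rw [← whiskerLeft_comp_assoc, h]
    simp
  | cast i =>
    cases k with
    | zero => exact i.elim0
    | succ k =>
      rw [unitAt_castSucc, mulAt_castSucc]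
      simp only [Category.assoc, Iso.inv_hom_id_assoc, ← comp_whiskerRight_assoc]
      rw [unitAt_castSucc_comp_mulAt k i]
      simp

theorem unitAt_succ_comp_mulAt (k : ℕ) (i : Fin (k + 1)) :
    unitAt M (k + 1) i.succ ≫ mulAt M k i = 𝟙 (tpow M.X (k + 1)) := by
  induction i using Fin.lastCases with
  | last =>
    have h : (M.X ◁ M.mon.one) ≫ M.mon.mul = (ρ_ M.X).hom := MonObj.mul_one M.X
    rw [Fin.succ_last, mulAt_last, unitAt_last]
    simp only [Category.assoc, Iso.inv_hom_id_assoc, whisker_exchange_assoc]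
    simp [← whiskerLeft_comp_assoc, h]
  | cast i =>
    cases k with
    | zero => exact i.elim0
    | succ k =>
      rw [Fin.succ_castSucc, unitAt_castSucc, mulAt_castSucc]
      simp only [Category.assoc, Iso.inv_hom_id_assoc, ← comp_whiskerRight_assoc]
      rw [unitAt_succ_comp_mulAt k i]
      simp

theorem unitAt_succ_succ_comp_mulAt (k : ℕ) (i j : Fin (k + 1)) (hij : i ≤ j) :
    unitAt M (k + 2) j.succ.succ ≫ mulAt M (k + 1) i.castSucc =
      mulAt M k i ≫ unitAt M (k + 1) j.succ := by
  induction j using Fin.lastCases with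
  | last =>
    rw [Fin.succ_last, Fin.succ_last, mulAt_castSucc, unitAt_last, unitAt_last]
    simp [whisker_exchange_assoc]
  | cast j =>
    induction i using Fin.lastCases with
    | last => exact absurd hij (by simp)
    | cast i =>
      cases k with
      | zero => exact i.elim0
      | succ k =>
        rw [Fin.succ_castSucc, Fin.succ_castSucc, unitAt_castSucc, unitAt_castSucc,
          mulAt_castSucc M (k + 1), mulAt_castSucc M k]
        simp only [Category.assoc, Iso.inv_hom_id_assoc, ← comp_whiskerRight_assoc]
        rw [← unitAt_succ_succ_comp_mulAt k i j hij, mulAt_castSucc]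

theorem unitAt_castSucc_castSucc_comp_mulAt (k : ℕ) (i j : Fin (k + 1)) (hij : j ≤ i) :
    unitAt M (k + 2) j.castSucc.castSucc ≫ mulAt M (k + 1) i.succ =
      mulAt M k i ≫ unitAt M (k + 1) j.castSucc := by
  induction i using Fin.lastCases with
  | last =>
    rw [Fin.succ_last, mulAt_last, mulAt_last, unitAt_castSucc, unitAt_castSucc]
    simp only [Category.assoc, Iso.inv_hom_id_assoc, comp_whiskerRight,
        inv_hom_whiskerRight_assoc]
    simp [whisker_exchange_assoc]
  | cast i =>
    induction j using Fin.lastCases with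
    | last => exact absurd hij (by simp)
    | cast j =>
      cases k with
      | zero => exact i.elim0
      | succ k =>
        conv_rhs => rw [unitAt_castSucc, mulAt_castSucc]
        rw [Fin.succ_castSucc, unitAt_castSucc, mulAt_castSucc M (k + 1)]
        simp only [Category.assoc, Iso.inv_hom_id_assoc, ← comp_whiskerRight_assoc]
        rw [← unitAt_castSucc_castSucc_comp_mulAt k i j hij]

/-! ### Compatibility with isolating the first factor -/

theorem mulAt_succ_comp_splitFirst (k : ℕ) (i : Fin (k + 1)) :
    mulAt M (k + 1) i.succ ≫ splitFirst M.X (k + 1) =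
      splitFirst M.X (k + 2) ≫ M.X ◁ mulAt M k i := by
  induction i using Fin.lastCases with
  | last =>
    rw [Fin.succ_last, mulAt_last, mulAt_last, splitFirst_succ, splitFirst_succ, splitFirst_succ]
    simp [whisker_exchange_assoc]
  | cast i =>
    cases k with
    | zero => exact i.elim0
    | succ k =>
      rw [Fin.succ_castSucc, mulAt_castSucc, mulAt_castSucc, splitFirst_succ M.X (k + 1),
        splitFirst_succ M.X (k + 2)]
      simp only [Category.assoc, Iso.inv_hom_id_assoc, ← comp_whiskerRight_assoc]
      rw [mulAt_succ_comp_splitFirst k i]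
      simp

/-- Here the first two factors interact: both are isolated and then multiplied. This is the form in
which associativity of the left action can be applied. -/
theorem mulAt_zero_comp_splitFirst (k : ℕ) :
    mulAt M k 0 ≫ splitFirst M.X k = splitFirst M.X (k + 1) ≫ M.X ◁ splitFirst M.X k ≫
      (α_ M.X M.X (tpow M.X k)).inv ≫ M.mon.mul ▷ tpow M.X k := by
  induction k with
  | zero =>
    have h : M.mon.mul ≫ (ρ_ M.X).inv = 𝟙 (M.X ⊗ M.X) ≫ M.X ◁ (ρ_ M.X).inv ≫
      (α_ M.X M.X (𝟙_ C)).inv ≫ M.mon.mul ▷ 𝟙_ C := by simp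
    exact h
  | succ k ih =>
    have h : M.X ◁ M.X ◁ (tpowSucc M.X k).inv ≫ (α_ M.X M.X (tpow M.X (k + 1))).inv ≫
        M.mon.mul ▷ tpow M.X (k + 1) = (α_ M.X M.X (tpow M.X k ⊗ M.X)).inv ≫
          M.mon.mul ▷ (tpow M.X k ⊗ M.X) ≫ M.X ◁ (tpowSucc M.X k).inv := by
      rw [associator_inv_naturality_right_assoc, whisker_exchange]
    rw [← Fin.castSucc_zero, mulAt_castSucc, splitFirst_succ M.X k, splitFirst_succ M.X (k + 1)]
    simp only [Category.assoc, Iso.inv_hom_id_assoc, ← comp_whiskerRight_assoc]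
    rw [ih, splitFirst_succ M.X k]
    simp [h]

theorem unitAt_succ_comp_splitFirst (k : ℕ) (j : Fin (k + 1)) :
    unitAt M (k + 1) j.succ ≫ splitFirst M.X (k + 1) =
      splitFirst M.X k ≫ M.X ◁ unitAt M k j := by
  induction j using Fin.lastCases with
  | last =>
    rw [Fin.succ_last, unitAt_last, unitAt_last, splitFirst_succ]
    simp [whisker_exchange_assoc]
  | cast j =>
    cases k with
    | zero => exact j.elim0
    | succ k =>
      conv_rhs => rw [unitAt_castSucc, splitFirst_succ]
      rw [Fin.succ_castSucc, unitAt_castSucc, splitFirst_succ M.X (k + 1)]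
      simp only [Category.assoc, Iso.inv_hom_id_assoc, ← comp_whiskerRight_assoc]
      rw [unitAt_succ_comp_splitFirst k j]
      simp

theorem unitAt_zero_comp_splitFirst (k : ℕ) :
    unitAt M k 0 ≫ splitFirst M.X k = (λ_ (tpow M.X k)).inv ≫ M.mon.one ▷ tpow M.X k := by
  induction k with
  | zero =>
    have h : M.mon.one ≫ (ρ_ M.X).inv = (λ_ (𝟙_ C)).inv ≫ M.mon.one ▷ 𝟙_ C := by
      simp [unitors_inv_equal]
    exact h
  | succ k ih =>
    have h : (λ_ (tpow M.X (k + 1))).inv ≫ M.mon.one ▷ tpow M.X (k + 1) =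
        (tpowSucc M.X k).hom ≫ (λ_ (tpow M.X k ⊗ M.X)).inv ≫
          M.mon.one ▷ (tpow M.X k ⊗ M.X) ≫ M.X ◁ (tpowSucc M.X k).inv := by
      rw [← whisker_exchange, ← leftUnitor_inv_naturality_assoc, Iso.hom_inv_id_assoc]
    rw [h, ← Fin.castSucc_zero, unitAt_castSucc, splitFirst_succ]
    simp only [Category.assoc, Iso.inv_hom_id_assoc, ← comp_whiskerRight_assoc]
    rw [ih]
    simp

/-! ### Cosimplicial identities on cochains -/

variable {M} (X : Bimod M M)

theorem cofaceFun_zero (k : ℕ) (f : tpow M.X k ⟶ X.X) :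
    cofaceFun X k 0 f = splitFirst M.X k ≫ M.X ◁ f ≫ X.actLeft := by
  cases k <;> rfl

theorem cofaceFun_last (k : ℕ) (f : tpow M.X k ⟶ X.X) :
    cofaceFun X k (Fin.last (k + 1)) f = (tpowSucc M.X k).hom ≫ f ▷ M.X ≫ X.actRight := by
  cases k with
  | zero => rfl
  | succ k =>
    have h : f ▷ M.X ≫ X.actRight = 𝟙 (tpow M.X (k + 1) ⊗ M.X) ≫ f ▷ M.X ≫ X.actRight := by simp
    exact (Fin.lastCases_last (motive := fun _ => tpow M.X (k + 2) ⟶ X.X)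
      (cast := fun l => mulAt M k l ≫ f)).trans h

theorem cofaceFun_castSucc_succ (k : ℕ) (i : Fin (k + 1)) (f : tpow M.X (k + 1) ⟶ X.X) :
    cofaceFun X (k + 1) i.castSucc.succ f = mulAt M k i ≫ f :=
  Fin.lastCases_castSucc (motive := fun _ => tpow M.X (k + 2) ⟶ X.X)
    (cast := fun l => mulAt M k l ≫ f) i

/-- The bimodule axioms sit at the corners: `i = j = 0` is associativity of the left action, `i = j`
last that of the right action, and `i = 0` with `j` last is the compatibility of the two actions.
Two inner cofaces reduce to `mulAt_comp_mulAt`. -/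
theorem cofaceFun_cofaceFun (k : ℕ) (i j : Fin (k + 2)) (hij : i ≤ j) (f : tpow M.X k ⟶ X.X) :
    cofaceFun X (k + 1) j.succ (cofaceFun X k i f) =
      cofaceFun X (k + 1) i.castSucc (cofaceFun X k j f) := by
  induction i using Fin.cases with
  | zero =>
    rw [Fin.castSucc_zero, cofaceFun_zero, cofaceFun_zero]
    induction j using Fin.cases with
    | zero =>
      rw [show (Fin.succ 0 : Fin (k + 3)) = Fin.succ (Fin.castSucc 0) from rfl,
        cofaceFun_castSucc_succ, cofaceFun_zero,
        reassoc_of% (mulAt_zero_comp_splitFirst M k)]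
      have h : (M.mon.mul ▷ X.X) ≫ X.actLeft =
        (α_ M.X M.X X.X).hom ≫ M.X ◁ X.actLeft ≫ X.actLeft := X.left_assoc
      simp [← whisker_exchange_assoc, h]
    | succ j =>
      induction j using Fin.lastCases with
      | last =>
        rw [Fin.succ_last, Fin.succ_last, cofaceFun_last, cofaceFun_last, splitFirst_succ]
        -- The compatibility of the two actions enters here, through the simp lemma for
        -- `Bimod.middle_assoc`.
        simp
      | cast j =>
        cases k with
        | zero => exact j.elim0
        | succ k =>
          rw [Fin.succ_castSucc, cofaceFun_castSucc_succ, ← Fin.succ_castSucc,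
            cofaceFun_castSucc_succ, reassoc_of% (mulAt_succ_comp_splitFirst M k j)]
          simp
  | succ i =>
    obtain ⟨j, rfl⟩ := Fin.exists_succ_eq.mpr (Fin.ne_zero_of_lt (lt_of_lt_of_le i.succ_pos hij))
    induction j using Fin.lastCases with
    | last =>
      rw [Fin.succ_last, Fin.succ_last, cofaceFun_last, ← Fin.succ_castSucc,
        cofaceFun_castSucc_succ, cofaceFun_last]
      induction i using Fin.lastCases with
      | last =>
        rw [Fin.succ_last, cofaceFun_last, mulAt_last]
        have h : (X.X ◁ M.mon.mul) ≫ X.actRight =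
          (α_ X.X M.X M.X).inv ≫ X.actRight ▷ M.X ≫ X.actRight := X.right_assoc
        simp [whisker_exchange_assoc, h]
      | cast i =>
        cases k with
        | zero => exact i.elim0
        | succ k =>
          rw [cofaceFun_castSucc_succ, mulAt_castSucc]
          simp
    | cast j =>
      cases k with
      | zero => exact j.elim0
      | succ k =>
        induction i using Fin.lastCases with
        | last => exact absurd (Fin.succ_le_succ_iff.mp hij) (not_le.mpr j.castSucc_lt_last)
        | cast i =>
          rw [cofaceFun_castSucc_succ, cofaceFun_castSucc_succ, Fin.succ_castSucc,
            cofaceFun_castSucc_succ, ← Fin.succ_castSucc i.castSucc, cofaceFun_castSucc_succ]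
          rw [← Category.assoc, ← Category.assoc, mulAt_comp_mulAt M k i j (by simpa using hij)]

theorem unitAt_comp_cofaceFun_of_le (k : ℕ) (i : Fin (k + 2)) (j : Fin (k + 1))
    (hij : i ≤ j.castSucc) (f : tpow M.X (k + 1) ⟶ X.X) :
    unitAt M (k + 1) j.succ ≫ cofaceFun X (k + 1) i.castSucc f =
      cofaceFun X k i (unitAt M k j ≫ f) := by
  induction i using Fin.cases with
  | zero =>
    rw [Fin.castSucc_zero, cofaceFun_zero, cofaceFun_zero,
      reassoc_of% (unitAt_succ_comp_splitFirst M k j)]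
    simp
  | succ i =>
    cases k with
    | zero =>
      obtain rfl := Fin.eq_zero j
      exact absurd (i.succ_pos.trans_le hij) (lt_irrefl _)
    | succ k =>
      have hlt := Fin.castSucc_lt_castSucc_iff.mp (i.castSucc_lt_succ.trans_le hij)
      obtain ⟨j, rfl⟩ := Fin.exists_succ_eq.mpr (Fin.ne_zero_of_lt hlt)
      obtain ⟨i, rfl⟩ := Fin.exists_castSucc_eq.mpr (Fin.ne_last_of_lt hlt)
      rw [← Fin.succ_castSucc, cofaceFun_castSucc_succ, cofaceFun_castSucc_succ,
        ← Category.assoc, ← Category.assoc,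
        unitAt_succ_succ_comp_mulAt M k i j (Fin.castSucc_lt_succ_iff.mp hlt)]

theorem unitAt_comp_cofaceFun_of_gt (k : ℕ) (i : Fin (k + 2)) (j : Fin (k + 1))
    (hij : j.castSucc < i) (f : tpow M.X (k + 1) ⟶ X.X) :
    unitAt M (k + 1) j.castSucc ≫ cofaceFun X (k + 1) i.succ f =
      cofaceFun X k i (unitAt M k j ≫ f) := by
  obtain ⟨i, rfl⟩ := Fin.exists_succ_eq.mpr (Fin.ne_zero_of_lt hij)
  induction i using Fin.lastCases with
  | last =>
    rw [Fin.succ_last, Fin.succ_last, cofaceFun_last, cofaceFun_last, unitAt_castSucc]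
    simp
  | cast i =>
    cases k with
    | zero => exact i.elim0
    | succ k =>
      induction j using Fin.lastCases with
      | last => exact absurd i.castSucc_lt_last (not_lt.mpr (Fin.castSucc_lt_succ_iff.mp hij))
      | cast j =>
        rw [cofaceFun_castSucc_succ, Fin.succ_castSucc, cofaceFun_castSucc_succ,
          ← Category.assoc, ← Category.assoc,
          unitAt_castSucc_castSucc_comp_mulAt M k i j (Fin.castSucc_lt_succ_iff.mp hij)]

/-- At `i = 0` the inserted unit acts on `X` from the left; elsewhere it is the right one of two
multiplied factors. -/
theorem unitAt_comp_cofaceFun_castSucc (k : ℕ) (i : Fin (k + 1)) (f : tpow M.X k ⟶ X.X) :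
    unitAt M k i ≫ cofaceFun X k i.castSucc f = f := by
  induction i using Fin.cases with
  | zero =>
    have h : (M.mon.one ▷ X.X) ≫ X.actLeft = (λ_ X.X).hom := X.one_actLeft
    rw [Fin.castSucc_zero, cofaceFun_zero, reassoc_of% (unitAt_zero_comp_splitFirst M k),
      ← whisker_exchange_assoc, h]
    simp
  | succ i =>
    cases k with
    | zero => exact i.elim0
    | succ k =>
      rw [← Fin.succ_castSucc, cofaceFun_castSucc_succ,
        reassoc_of% (unitAt_succ_comp_mulAt M k i)]

theorem unitAt_comp_cofaceFun_succ (k : ℕ) (i : Fin (k + 1)) (f : tpow M.X k ⟶ X.X) :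
    unitAt M k i ≫ cofaceFun X k i.succ f = f := by
  induction i using Fin.lastCases with
  | last =>
    have h : (X.X ◁ M.mon.one) ≫ X.actRight = (ρ_ X.X).hom := X.actRight_one
    rw [Fin.succ_last, cofaceFun_last, unitAt_last]
    simp [whisker_exchange_assoc, h]
  | cast i =>
    cases k with
    | zero => exact i.elim0
    | succ k =>
      rw [cofaceFun_castSucc_succ, reassoc_of% (unitAt_castSucc_comp_mulAt M k i)]

end Hochschild

/-! ### The simplex category by generators and relations -/

namespace SimplexCategoryGenRel
open SimplexCategory

/-- A composition of face maps whose image omits `i` ends, up to the relations, with the `i`-th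
face map. -/
theorem exists_eq_comp_δ_of_P_δ {n : ℕ} {x : SimplexCategoryGenRel} (m : x ⟶ mk (n + 1))
    (hm : P_δ m) (i : Fin (n + 2)) (hi : ∀ a, (toSimplexCategory.map m).toOrderHom a ≠ i) :
    ∃ m' : x ⟶ mk n, P_δ m' ∧ m = m' ≫ δ i := by
  -- Peel off the last face `δ j`. If `j ≠ i`, the remaining word omits the vertex that `δ j` sends
  -- to `i`; by recursion it ends in the corresponding face, which is then moved past `δ j`.
  suffices key : ∀ (m : x ⟶ mk n) (_ : P_δ m) (j : Fin (n + 2))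
      (_ : ∀ a, j.succAbove ((toSimplexCategory.map m).toOrderHom a) ≠ i),
      ∃ m' : x ⟶ mk n, P_δ m' ∧ m ≫ δ j = m' ≫ δ i by
    cases hm with
    | of f h =>
      rcases h with ⟨j⟩
      simpa using! key (𝟙 _) (P_δ.id_mem _) j hi
    | id => exact absurd rfl (hi i)
    | comp_of f g hf hg =>
      rcases hg with ⟨j⟩
      refine key f hf j fun a ha => hi a ?_
      rw [Functor.map_comp]
      exact ha
  intro m hm j hi
  by_cases hij : i = j
  · subst hij
    exact ⟨m, hm, rfl⟩
  cases n with
  | zero =>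
    obtain ⟨b, hb⟩ := Fin.exists_succAbove_eq hij
    refine absurd ?_ (hi 0)
    rw [← hb]
    congr 1
    exact Subsingleton.elim (α := Fin 1) _ _
  | succ n =>
    rcases lt_or_gt_of_ne hij with h | h
    · obtain ⟨j, rfl⟩ := Fin.exists_succ_eq.mpr (Fin.ne_zero_of_lt h)
      obtain ⟨i, rfl⟩ := Fin.exists_castSucc_eq.mpr (Fin.ne_last_of_lt h)
      have hle : i ≤ j := Fin.castSucc_lt_succ_iff.mp h
      obtain ⟨m', hm', rfl⟩ := exists_eq_comp_δ_of_P_δ m hm i (fun a ha => hi a (by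
        rw [ha, Fin.succAbove_of_castSucc_lt _ _ h]))
      refine ⟨m' ≫ δ j, P_δ.comp_mem _ _ hm' (P_δ.δ j), ?_⟩
      rw [Category.assoc, Category.assoc, δ_comp_δ hle]
    · obtain ⟨i, rfl⟩ := Fin.exists_succ_eq.mpr (Fin.ne_zero_of_lt h)
      obtain ⟨j, rfl⟩ := Fin.exists_castSucc_eq.mpr (Fin.ne_last_of_lt h)
      have hle : j ≤ i := Fin.castSucc_lt_succ_iff.mp h
      obtain ⟨m', hm', rfl⟩ := exists_eq_comp_δ_of_P_δ m hm i (fun a ha => hi a (by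
        rw [ha, Fin.succAbove_of_lt_succ _ _ h]))
      refine ⟨m' ≫ δ j, P_δ.comp_mem _ _ hm' (P_δ.δ j), ?_⟩
      rw [Category.assoc, Category.assoc, δ_comp_δ hle]

/-- A composition of degeneracy maps which identifies `i` and `i + 1` starts, up to the relations,
with the `i`-th degeneracy map. -/
theorem exists_eq_σ_comp_of_P_σ {n : ℕ} {y : SimplexCategoryGenRel} (e : mk (n + 1) ⟶ y)
    (he : P_σ e) (i : Fin (n + 1)) (hi : (toSimplexCategory.map e).toOrderHom i.castSucc =
      (toSimplexCategory.map e).toOrderHom i.succ) :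
    ∃ e' : mk n ⟶ y, P_σ e' ∧ e = σ i ≫ e' := by
  suffices key : ∀ (e : mk n ⟶ y) (_ : P_σ e) (j : Fin (n + 1))
      (_ : (toSimplexCategory.map e).toOrderHom (j.predAbove i.castSucc) =
        (toSimplexCategory.map e).toOrderHom (j.predAbove i.succ)),
      ∃ e' : mk n ⟶ y, P_σ e' ∧ σ j ≫ e = σ i ≫ e' by
    -- The primed closure builds words by adding a generator in front, so that the first degeneracy
    -- can be peeled off.
    rw [P_σ, MorphismProperty.multiplicativeClosure_eq_multiplicativeClosure'] at he
    cases he with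
    | of f h =>
      rcases h with ⟨j⟩
      simpa using! key (𝟙 _) (P_σ.id_mem _) j hi
    | id => exact absurd hi i.castSucc_lt_succ.ne
    | of_comp f g hf hg =>
      rcases hf with ⟨j⟩
      rw [← MorphismProperty.multiplicativeClosure_eq_multiplicativeClosure'] at hg
      refine key g hg j ?_
      rw [Functor.map_comp] at hi
      exact hi
  intro e he j hi
  by_cases hij : i = j
  · subst hij
    exact ⟨e, he, rfl⟩
  cases n with
  | zero => exact absurd (Subsingleton.elim (α := Fin 1) i j) hij
  | succ n =>
    rcases lt_or_gt_of_ne hij with h | h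
    · obtain ⟨j, rfl⟩ := Fin.exists_succ_eq.mpr (Fin.ne_zero_of_lt h)
      obtain ⟨i, rfl⟩ := Fin.exists_castSucc_eq.mpr (Fin.ne_last_of_lt h)
      have hle : i ≤ j := Fin.castSucc_lt_succ_iff.mp h
      rw [Fin.predAbove_of_le_castSucc _ _ (Fin.castSucc_le_castSucc_iff.mpr h.le),
        Fin.predAbove_of_le_castSucc _ _ (by simpa using h), Fin.castPred_castSucc] at hi
      obtain ⟨e', he', rfl⟩ := exists_eq_σ_comp_of_P_σ e he i hi
      refine ⟨σ j ≫ e', P_σ.comp_mem _ _ (P_σ.σ j) he', ?_⟩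
      rw [← Category.assoc, ← Category.assoc, σ_comp_σ hle]
    · obtain ⟨i, rfl⟩ := Fin.exists_succ_eq.mpr (Fin.ne_zero_of_lt h)
      obtain ⟨j, rfl⟩ := Fin.exists_castSucc_eq.mpr (Fin.ne_last_of_lt h)
      have hle : j ≤ i := Fin.castSucc_lt_succ_iff.mp h
      rw [Fin.predAbove_of_castSucc_lt _ _ (by simpa using h),
        Fin.predAbove_of_castSucc_lt _ _ ((Fin.castSucc_lt_castSucc_iff.mpr h).trans Fin.castSucc_lt_succ),
        Fin.pred_succ] at hi
      obtain ⟨e', he', rfl⟩ := exists_eq_σ_comp_of_P_σ e he i hi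
      refine ⟨σ j ≫ e', P_σ.comp_mem _ _ (P_σ.σ j) he', ?_⟩
      rw [← Category.assoc, ← Category.assoc, σ_comp_σ hle]

theorem eq_or_len_lt_of_P_σ {x y : SimplexCategoryGenRel} {f : x ⟶ y} (hf : P_σ f) :
    (∃ h : x = y, f = eqToHom h) ∨ y.len < x.len := by
  induction hf with
  | of _ hx => cases hx; right; simp
  | id => left; use rfl; simp
  | comp_of i u _ hg h' =>
    refine Or.inr ?_
    rcases h' with ⟨e, _⟩ | h' <;> cases hg
    · rw [e]
      exact Nat.lt_add_one _
    · exact (Nat.lt_succ_self _).trans h'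

/-- A nonidentity word in faces omits some vertex `i`, and an equal map omits it too. Both words can
then be written to end in `δ i`, which cancels as a monomorphism. -/
theorem eq_of_P_δ_of_map_eq {n : ℕ} {x : SimplexCategoryGenRel} (m m' : x ⟶ mk n)
    (hm : P_δ m) (hm' : P_δ m') (h : toSimplexCategory.map m = toSimplexCategory.map m') :
    m = m' := by
  rcases eq_or_len_le_of_P_δ hm with ⟨hx, rfl⟩ | hlt
  · rcases eq_or_len_le_of_P_δ hm' with ⟨_, rfl⟩ | hlt
    · rfl
    · exact absurd hlt (by simp [hx])
  · cases n with
    | zero => exact absurd hlt (by simp)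
    | succ n =>
      have hns : ¬ Function.Surjective (toSimplexCategory.map m).toOrderHom := fun hs =>
        absurd (@len_le_of_epi _ _ (toSimplexCategory.map m) (epi_iff_surjective.mpr hs))
          (by simpa using hlt)
      simp only [Function.Surjective, not_forall, not_exists] at hns
      obtain ⟨i, hi⟩ : ∃ i : Fin (n + 2), ∀ a, (toSimplexCategory.map m).toOrderHom a ≠ i := hns
      obtain ⟨m₁, hm₁, rfl⟩ := exists_eq_comp_δ_of_P_δ m hm i hi
      obtain ⟨m₂, hm₂, rfl⟩ := exists_eq_comp_δ_of_P_δ m' hm' i (h ▸ hi)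
      rw [Functor.map_comp, Functor.map_comp] at h
      rw [eq_of_P_δ_of_map_eq m₁ m₂ hm₁ hm₂ ((cancel_mono (SimplexCategory.δ i)).mp h)]

theorem eq_of_P_σ_of_map_eq {n : ℕ} {y : SimplexCategoryGenRel} (e e' : mk n ⟶ y)
    (he : P_σ e) (he' : P_σ e') (h : toSimplexCategory.map e = toSimplexCategory.map e') :
    e = e' := by
  rcases eq_or_len_lt_of_P_σ he with ⟨hx, rfl⟩ | hlt
  · rcases eq_or_len_lt_of_P_σ he' with ⟨_, rfl⟩ | hlt
    · rfl
    · exact absurd hlt (by simp [← hx])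
  · cases n with
    | zero => exact absurd hlt (by simp)
    | succ n =>
      obtain ⟨i, hi⟩ : ∃ i : Fin (n + 1), (toSimplexCategory.map e).toOrderHom i.castSucc =
          (toSimplexCategory.map e).toOrderHom i.succ := by
        -- A monotone map that identifies no two neighbours is injective, which the drop in length
        -- forbids.
        by_contra! hne
        have hs : StrictMono (toSimplexCategory.map e).toOrderHom :=
          Fin.strictMono_iff_lt_succ.mpr fun i =>
            lt_of_le_of_ne ((toSimplexCategory.map e).toOrderHom.monotone
              Fin.castSucc_lt_succ.le) (hne i)
        exact absurd (@len_le_of_mono _ _ (toSimplexCategory.map e)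
          (mono_iff_injective.mpr hs.injective)) (by simpa using hlt)
      obtain ⟨e₁, he₁, rfl⟩ := exists_eq_σ_comp_of_P_σ e he i hi
      obtain ⟨e₂, he₂, rfl⟩ := exists_eq_σ_comp_of_P_σ e' he' i (h ▸ hi)
      rw [Functor.map_comp, Functor.map_comp] at h
      rw [eq_of_P_σ_of_map_eq e₁ e₂ he₁ he₂ ((cancel_epi (SimplexCategory.σ i)).mp h)]

instance : toSimplexCategory.Faithful where
  map_injective {x y f g} h := by
    obtain ⟨z, e, m, he, hm, rfl⟩ := exists_P_σ_P_δ_factorization f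
    obtain ⟨z', e', m', he', hm', rfl⟩ := exists_P_σ_P_δ_factorization g
    have := isSplitEpi_toSimplexCategory_map_of_P_σ he
    have := isSplitEpi_toSimplexCategory_map_of_P_σ he'
    have := isSplitMono_toSimplexCategory_map_of_P_δ hm
    have := isSplitMono_toSimplexCategory_map_of_P_δ hm'
    rw [Functor.map_comp, Functor.map_comp] at h
    obtain rfl : z = z' := by
      have h₁ := image_eq h
      have h₂ := image_eq (rfl : toSimplexCategory.map e' ≫ toSimplexCategory.map m' = _)
      exact ext (congrArg SimplexCategory.len (h₁.symm.trans h₂))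
    -- The comparison of the two middle objects is a monic endomorphism in the simplex category,
    -- hence the identity. The face parts therefore agree, and cancelling them gives the degeneracy
    -- parts.
    have hfac : toSimplexCategory.map m =
        (section_ (toSimplexCategory.map e) ≫ toSimplexCategory.map e') ≫
          toSimplexCategory.map m' := by
      rw [Category.assoc, ← h, IsSplitEpi.id_assoc]
    have : Mono (section_ (toSimplexCategory.map e) ≫ toSimplexCategory.map e') :=
      mono_of_mono_fac hfac.symm
    rw [eq_id_of_mono (section_ (toSimplexCategory.map e) ≫ toSimplexCategory.map e'),
      Category.id_comp] at hfac
    rw [hfac, cancel_mono] at h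
    induction x using SimplexCategoryGenRel.rec with | _ n
    induction y using SimplexCategoryGenRel.rec with | _ l
    rw [eq_of_P_σ_of_map_eq e e' he he' h, eq_of_P_δ_of_map_eq m m' hm hm' hfac]

theorem exists_map_eq {n l : ℕ} (f : SimplexCategory.mk n ⟶ SimplexCategory.mk l) :
    ∃ g : mk n ⟶ mk l, toSimplexCategory.map g = f := by
  let W : MorphismProperty SimplexCategory := fun x y f =>
    ∃ g : mk x.len ⟶ mk y.len, toSimplexCategory.map g = f
  have : W.IsMultiplicative :=
    { id_mem := fun x => ⟨𝟙 _, toSimplexCategory.map_id _⟩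
      comp_mem := by
        rintro x y z _ _ ⟨g, rfl⟩ ⟨g', rfl⟩
        exact ⟨g ≫ g', toSimplexCategory.map_comp g g'⟩ }
  have hW : W = ⊤ := morphismProperty_eq_top W (fun i => ⟨δ i, rfl⟩) (fun i => ⟨σ i, rfl⟩)
  have hf : W f := hW ▸ MorphismProperty.top_apply f
  exact hf

instance : toSimplexCategory.Full where
  map_surjective {x y} f := by
    induction x using SimplexCategoryGenRel.rec with | _ n
    induction y using SimplexCategoryGenRel.rec with | _ l
    exact exists_map_eq f

/-- The inverse of the canonical functor `SimplexCategoryGenRel ⥤ SimplexCategory`. -/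
noncomputable def ofSimplexCategory : SimplexCategory ⥤ SimplexCategoryGenRel where
  obj x := mk x.len
  map {x y} f := toSimplexCategory.preimage (X := mk x.len) (Y := mk y.len) f
  map_id x := toSimplexCategory.preimage_id (X := mk x.len)
  map_comp {x y z} f g :=
    toSimplexCategory.preimage_comp (X := mk x.len) (Y := mk y.len) (Z := mk z.len) f g

theorem ofSimplexCategory_map_toSimplexCategory_map {n l : ℕ} (f : mk n ⟶ mk l) :
    ofSimplexCategory.map (toSimplexCategory.map f) = f :=
  toSimplexCategory.preimage_map f

end SimplexCategoryGenRel

/-! ### From the identities to a functor -/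

namespace CategoryTheory.CosimplicialObject

universe v' u'

/-- A family of objects with cofaces and codegeneracies which satisfy the cosimplicial identities
comes from a cosimplicial object. -/
theorem exists_of_cosimplicial_identities {D : Type u'} [Category.{v'} D] (A : ℕ → D)
    (d : ∀ (k : ℕ), Fin (k + 2) → (A k ⟶ A (k + 1)))
    (s : ∀ (k : ℕ), Fin (k + 1) → (A (k + 1) ⟶ A k))
    (d_comp_d : ∀ (k : ℕ) (i j : Fin (k + 2)), i ≤ j →
      d k i ≫ d (k + 1) j.succ = d k j ≫ d (k + 1) i.castSucc)
    (s_comp_s : ∀ (k : ℕ) (i j : Fin (k + 1)), i ≤ j →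
      s (k + 1) i.castSucc ≫ s k j = s (k + 1) j.succ ≫ s k i)
    (d_comp_s_of_le : ∀ (k : ℕ) (i : Fin (k + 2)) (j : Fin (k + 1)), i ≤ j.castSucc →
      d (k + 1) i.castSucc ≫ s (k + 1) j.succ = s k j ≫ d k i)
    (d_comp_s_self : ∀ (k : ℕ) (i : Fin (k + 1)), d k i.castSucc ≫ s k i = 𝟙 (A k))
    (d_comp_s_succ : ∀ (k : ℕ) (i : Fin (k + 1)), d k i.succ ≫ s k i = 𝟙 (A k))
    (d_comp_s_of_gt : ∀ (k : ℕ) (i : Fin (k + 2)) (j : Fin (k + 1)), j.castSucc < i →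
      d (k + 1) i.succ ≫ s (k + 1) j.castSucc = s k j ≫ d k i) :
    ∃ (F : CosimplicialObject D) (hF : ∀ k : ℕ, F.obj (SimplexCategory.mk k) = A k),
      (∀ (k : ℕ) (i : Fin (k + 2)),
        F.δ i = eqToHom (hF k) ≫ d k i ≫ eqToHom (hF (k + 1)).symm) ∧
      (∀ (k : ℕ) (i : Fin (k + 1)),
        F.σ i = eqToHom (hF (k + 1)) ≫ s k i ≫ eqToHom (hF k).symm) := by
  let φ : FreeSimplexQuiver ⥤q D :=
    { obj := A
      map := fun f => match f with
        | FreeSimplexQuiver.Hom.δ i => d _ i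
        | FreeSimplexQuiver.Hom.σ i => s _ i }
  have hd {k : ℕ} (i : Fin (k + 2)) :
      (Paths.lift φ).map ((Paths.of FreeSimplexQuiver).map (FreeSimplexQuiver.δ i)) = d k i :=
    Category.id_comp _
  have hs {k : ℕ} (i : Fin (k + 1)) :
      (Paths.lift φ).map ((Paths.of FreeSimplexQuiver).map (FreeSimplexQuiver.σ i)) = s k i :=
    Category.id_comp _
  let G : SimplexCategoryGenRel ⥤ D := CategoryTheory.Quotient.lift _ (Paths.lift φ) (by
    intro x y f g h
    cases h with
    | δ_comp_δ H => simp only [Functor.map_comp, hd]; exact d_comp_d _ _ _ H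
    | δ_comp_σ_of_le H => simp only [Functor.map_comp, hd, hs]; exact d_comp_s_of_le _ _ _ H
    | δ_comp_σ_self =>
      simp only [Functor.map_comp, Functor.map_id, hd, hs]; exact d_comp_s_self _ _
    | δ_comp_σ_succ =>
      simp only [Functor.map_comp, Functor.map_id, hd, hs]; exact d_comp_s_succ _ _
    | δ_comp_σ_of_gt H => simp only [Functor.map_comp, hd, hs]; exact d_comp_s_of_gt _ _ _ H
    | σ_comp_σ H => simp only [Functor.map_comp, hs]; exact s_comp_s _ _ _ H)
  have hδ (k : ℕ) (i : Fin (k + 2)) :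
      G.map (SimplexCategoryGenRel.ofSimplexCategory.map (SimplexCategory.δ i)) = d k i :=
    (congrArg G.map (SimplexCategoryGenRel.ofSimplexCategory_map_toSimplexCategory_map
      (SimplexCategoryGenRel.δ i))).trans (hd i)
  have hσ (k : ℕ) (i : Fin (k + 1)) :
      G.map (SimplexCategoryGenRel.ofSimplexCategory.map (SimplexCategory.σ i)) = s k i :=
    (congrArg G.map (SimplexCategoryGenRel.ofSimplexCategory_map_toSimplexCategory_map
      (SimplexCategoryGenRel.σ i))).trans (hs i)
  have key {x y : D} (f : x ⟶ y) : f = 𝟙 x ≫ f ≫ 𝟙 y := by simp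
  -- `ofSimplexCategory` is given on objects by an explicit formula, so the object equalities hold
  -- by definition and each `eqToHom` is an identity.
  exact ⟨SimplexCategoryGenRel.ofSimplexCategory ⋙ G, fun _ => rfl,
    fun k i => (hδ k i).trans (key _), fun k i => (hσ k i).trans (key _)⟩

end CategoryTheory.CosimplicialObject

theorem mainTheorem1 {C : Type u} [Category.{v} C] [MonoidalCategory C] [Preadditive C]
    [MonoidalPreadditive C] (M : Mon C) (X : Bimod M M) :
    -- the cosimplicial identities
    (∀ (k : ℕ) (i j : Fin (k + 2)), i ≤ j →
      Hochschild.coface X k i ≫ Hochschild.coface X (k + 1) j.succ =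
        Hochschild.coface X k j ≫ Hochschild.coface X (k + 1) i.castSucc) ∧
    (∀ (k : ℕ) (i j : Fin (k + 1)), i ≤ j →
      Hochschild.codegeneracy X (k + 1) i.castSucc ≫ Hochschild.codegeneracy X k j =
        Hochschild.codegeneracy X (k + 1) j.succ ≫ Hochschild.codegeneracy X k i) ∧
    (∀ (k : ℕ) (i : Fin (k + 2)) (j : Fin (k + 1)), i ≤ j.castSucc →
      Hochschild.coface X (k + 1) i.castSucc ≫ Hochschild.codegeneracy X (k + 1) j.succ =
        Hochschild.codegeneracy X k j ≫ Hochschild.coface X k i) ∧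
    (∀ (k : ℕ) (i : Fin (k + 1)),
      Hochschild.coface X k i.castSucc ≫ Hochschild.codegeneracy X k i =
        𝟙 (Hochschild.cochain X k)) ∧
    (∀ (k : ℕ) (i : Fin (k + 1)),
      Hochschild.coface X k i.succ ≫ Hochschild.codegeneracy X k i =
        𝟙 (Hochschild.cochain X k)) ∧
    (∀ (k : ℕ) (i : Fin (k + 2)) (j : Fin (k + 1)), j.castSucc < i →
      Hochschild.coface X (k + 1) i.succ ≫ Hochschild.codegeneracy X (k + 1) j.castSucc =
        Hochschild.codegeneracy X k j ≫ Hochschild.coface X k i) ∧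
    -- the resulting functor from the simplex category to abelian groups
    (∃ (A : CosimplicialObject AddCommGrpCat.{v})
      (hA : ∀ k : ℕ, A.obj (SimplexCategory.mk k) = Hochschild.cochain X k),
      (∀ (k : ℕ) (i : Fin (k + 2)),
        A.δ i = eqToHom (hA k) ≫ Hochschild.coface X k i ≫ eqToHom (hA (k + 1)).symm) ∧
      (∀ (k : ℕ) (i : Fin (k + 1)),
        A.σ i = eqToHom (hA (k + 1)) ≫ Hochschild.codegeneracy X k i ≫ eqToHom (hA k).symm)) := by
  have h₁ (k : ℕ) (i j : Fin (k + 2)) (hij : i ≤ j) :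
      Hochschild.coface X k i ≫ Hochschild.coface X (k + 1) j.succ =
        Hochschild.coface X k j ≫ Hochschild.coface X (k + 1) i.castSucc := by
    ext f
    exact Hochschild.cofaceFun_cofaceFun X k i j hij f
  have h₂ (k : ℕ) (i j : Fin (k + 1)) (hij : i ≤ j) :
      Hochschild.codegeneracy X (k + 1) i.castSucc ≫ Hochschild.codegeneracy X k j =
        Hochschild.codegeneracy X (k + 1) j.succ ≫ Hochschild.codegeneracy X k i := by
    ext f
    -- Codegeneracies are precompositions, so the order reverses: `unitAt` for `j` comes first.
    exact (Category.assoc _ _ _).symm.trans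
      ((congrArg (· ≫ f) (Hochschild.unitAt_comp_unitAt M k i j hij)).trans (Category.assoc _ _ _))
  have h₃ (k : ℕ) (i : Fin (k + 2)) (j : Fin (k + 1)) (hij : i ≤ j.castSucc) :
      Hochschild.coface X (k + 1) i.castSucc ≫ Hochschild.codegeneracy X (k + 1) j.succ =
        Hochschild.codegeneracy X k j ≫ Hochschild.coface X k i := by
    ext f
    exact Hochschild.unitAt_comp_cofaceFun_of_le X k i j hij f
  have h₄ (k : ℕ) (i : Fin (k + 1)) :
      Hochschild.coface X k i.castSucc ≫ Hochschild.codegeneracy X k i =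
        𝟙 (Hochschild.cochain X k) := by
    ext f
    exact Hochschild.unitAt_comp_cofaceFun_castSucc X k i f
  have h₅ (k : ℕ) (i : Fin (k + 1)) :
      Hochschild.coface X k i.succ ≫ Hochschild.codegeneracy X k i =
        𝟙 (Hochschild.cochain X k) := by
    ext f
    exact Hochschild.unitAt_comp_cofaceFun_succ X k i f
  have h₆ (k : ℕ) (i : Fin (k + 2)) (j : Fin (k + 1)) (hij : j.castSucc < i) :
      Hochschild.coface X (k + 1) i.succ ≫ Hochschild.codegeneracy X (k + 1) j.castSucc =
        Hochschild.codegeneracy X k j ≫ Hochschild.coface X k i := by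
    ext f
    exact Hochschild.unitAt_comp_cofaceFun_of_gt X k i j hij f
  exact ⟨h₁, h₂, h₃, h₄, h₅, h₆, CosimplicialObject.exists_of_cosimplicial_identities
    (Hochschild.cochain X) (Hochschild.coface X) (Hochschild.codegeneracy X) h₁ h₂ h₃ h₄ h₅ h₆⟩
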